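/- Let $n$ and $p$ be integers with $2\le p\le\lfloor n/2\rfloor$, and let $G$ be a graph obtained from the complete graph $K_n$ by deleting $p$ of its edges. Then $G$ is connected. Let $\delta$ be the minimum degree of $G$, let $t(G)$ be the number of spanning trees of $G$, and let $$Kf(G)=\sum_{i<j}r_G(v_i,v_j)$$ be the Kirchhoff index of $G$, where $v_1,\dots,v_n$ are the vertices of $G$ and $r_G(v_i,v_j)$ is the resistance distance, that is, the effective resistance between $v_i$ and $v_j$ in the electrical network obtained from $G$ by replacing each edge with a unit resistor. Then $$Kf(G)\le n-1-p+\frac{n}{n-p-1}+\frac{(p-1)\,\delta\,n^{\,n-p-1}\,(n-1)^{p-2}}{t(G)},$$ and equality holds if and only if $G\cong K_n-K_{1,p}$, the graph obtained from $K_n$ by deleting all edges of a star $K_{1,p}$ contained in it. -/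

import Mathlib

/-- `φ` is an electric potential on the network obtained from `G` by replacing every edge by a unit
resistor, when a unit current enters the network at `u` and leaves it at `v`. By Ohm's law the
current along an edge from `w` to `x` is `φ w - φ x`, and by Kirchhoff's current law the total
current flowing from `w` to its neighbours equals the current injected at `w`. -/
def IsUnitCurrentPotential {V : Type*} [Fintype V] [DecidableEq V] (G : SimpleGraph V)
    [DecidableRel G.Adj] (u v : V) (φ : V → ℝ) : Prop :=
  ∀ w : V, ∑ x ∈ G.neighborFinset w, (φ w - φ x) =
    (if w = u then 1 else 0) - (if w = v then 1 else 0)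

/-- The potential difference between `u` and `v` does not depend on the choice of the potential. -/
theorem IsUnitCurrentPotential.sub_eq_sub {V : Type*} [Fintype V] [DecidableEq V]
    {G : SimpleGraph V} [DecidableRel G.Adj] {u v : V} {φ ψ : V → ℝ}
    (hφ : IsUnitCurrentPotential G u v φ) (hψ : IsUnitCurrentPotential G u v ψ) :
    φ u - φ v = ψ u - ψ v := by
  have key : ∀ f g : V → ℝ, IsUnitCurrentPotential G u v g →
      f u - f v = ∑ w, ∑ x, if G.Adj w x then f w * (g w - g x) else 0 := by
    intro f g hg
    have h : ∀ w, (∑ x, if G.Adj w x then f w * (g w - g x) else 0) =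
        f w * ((if w = u then 1 else 0) - (if w = v then 1 else 0)) := by
      intro w
      rw [← hg w, Finset.mul_sum, ← Finset.sum_filter]
      congr 1
      ext x
      simp
    rw [Finset.sum_congr rfl fun w _ => h w]
    simp [mul_sub]
  have e1 := key φ ψ hψ
  have e2 := key ψ φ hφ
  have e3 : ∑ w, ∑ x, (if G.Adj w x then φ w * ψ x else 0) =
      ∑ w, ∑ x, (if G.Adj w x then ψ w * φ x else 0) := by
    rw [Finset.sum_comm]
    refine Finset.sum_congr rfl fun w _ => Finset.sum_congr rfl fun x _ => ?_
    simp only [G.adj_comm x w, mul_comm]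
  rw [e1, e2, ← sub_eq_zero, ← Finset.sum_sub_distrib]
  simp_rw [← Finset.sum_sub_distrib]
  rw [← sub_eq_zero, ← Finset.sum_sub_distrib] at e3
  simp_rw [← Finset.sum_sub_distrib] at e3
  rw [← neg_eq_zero, ← Finset.sum_neg_distrib] at e3
  simp_rw [← Finset.sum_neg_distrib] at e3
  rw [← e3]
  refine Finset.sum_congr rfl fun w _ => Finset.sum_congr rfl fun x _ => ?_
  split_ifs <;> ring

open Classical in
/-- The resistance distance `r_G(u, v)`: the potential difference between `u` and `v` when a unit
current flows from `u` to `v` in the network of unit resistors given by `G`. (If no such flow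
exists, that is, if `u` and `v` lie in different components, the value is the default `0`.) -/
noncomputable def resistanceDistance {V : Type*} [Fintype V] [DecidableEq V] (G : SimpleGraph V)
    [DecidableRel G.Adj] (u v : V) : ℝ :=
  if h : ∃ φ : V → ℝ, IsUnitCurrentPotential G u v φ then h.choose u - h.choose v else 0

/-- Any potential of a unit current from `u` to `v` computes the resistance distance. -/
theorem IsUnitCurrentPotential.resistanceDistance_eq {V : Type*} [Fintype V] [DecidableEq V]
    {G : SimpleGraph V} [DecidableRel G.Adj] {u v : V} {φ : V → ℝ}
    (hφ : IsUnitCurrentPotential G u v φ) : resistanceDistance G u v = φ u - φ v := by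
  have h : ∃ φ : V → ℝ, IsUnitCurrentPotential G u v φ := ⟨φ, hφ⟩
  rw [resistanceDistance, dif_pos h]
  exact h.choose_spec.sub_eq_sub hφ

/-- The Kirchhoff index: the sum of the resistance distances over all unordered pairs of distinct
vertices. -/
noncomputable def kirchhoffIndex {n : ℕ} (G : SimpleGraph (Fin n)) [DecidableRel G.Adj] : ℝ :=
  ∑ i : Fin n, ∑ j ∈ Finset.Ioi i, resistanceDistance G i j

/-- The number of spanning trees: trees on the full vertex set all of whose edges are in `G`. -/
noncomputable def numSpanningTrees {V : Type*} (G : SimpleGraph V) : ℕ :=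
  Nat.card {T : SimpleGraph V // T ≤ G ∧ T.IsTree}

/-- `G` is isomorphic to `K_V - H`, the graph obtained from the complete graph on `V` by deleting
all edges of a copy of `H` contained in it. -/
def IsCompleteMinus {V W : Type*} (G : SimpleGraph V) (H : SimpleGraph W) : Prop :=
  ∃ f : W ↪ V, Nonempty (G ≃g (⊤ : SimpleGraph V) \ H.map f)

/-! Write `L` for the Laplacian of `G`, `J` for the all-ones matrix, and `μ` for the Laplacian
eigenvalues of the complement, which has `p` edges. Then `L + J = n I - L(Gᶜ)`, so everything is
governed by the numbers `n - μ`. The matrix-tree theorem gives `det (L + J) = n² t(G)`, and `Kf(G) =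
n tr (L + J)⁻¹ - 1`.

At most `p` of the `μ` are nonzero. Let `l = n - μ₁` belong to the largest one and let `x i` be the
values for `p - 1` others that include all remaining nonzero `μ`. Then `t(G) = n^(n-p-2) l ∏ x i`
and `Kf(G) = n - 1 - p + n/l + n ∑ 1/x i`. Two eigenvalue bounds finish the estimate. From `μ₁ ≤ p +
1` comes `l ≥ n - p - 1`, which bounds `n/l`; as `∑ μ = 2p`, it also gives `∑ x i ≤ (p-1)(n-1)`, so
Maclaurin's inequality bounds the numerator of `∑ 1/x i = (∑ i, ∏_{j ≠ i} x j) / ∏ x j`. From `μ₁ ≥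
Δ(Gᶜ) + 1` comes `l ≤ δ`, which turns `1/∏ x i` into the factor `δ/t(G)`.

Equality forces `μ₁ = p + 1`, hence all missing edges share a vertex. Conversely, for a star the
trace of the squared Laplacian shows that the `p - 1` other eigenvalues are `1`, and every estimate
is sharp. -/

namespace SimpleGraph

/-! ### Spanning trees as parent functions -/

variable {V : Type*}

/-- The graph whose edges join every vertex other than the root `r` to its image under `f`. -/
def parentGraph (r : V) (f : V → V) : SimpleGraph V :=
  SimpleGraph.fromRel fun u v => u ≠ r ∧ f u = v

/-- Every vertex reaches the root `r` by iterating `f`. -/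
def ReachesRoot (r : V) (f : V → V) : Prop := ∀ w, ∃ k, f^[k] w = r

theorem parentGraph_le {G : SimpleGraph V} {r : V} {f : V → V}
    (hf : ∀ w, w ≠ r → G.Adj w (f w)) : parentGraph r f ≤ G := by
  intro u v h
  rw [parentGraph, SimpleGraph.fromRel_adj] at h
  obtain ⟨-, ⟨h1, rfl⟩ | ⟨h1, rfl⟩⟩ := h
  · exact hf _ h1
  · exact (hf _ h1).symm

theorem parentGraph_adj {r : V} {f : V → V} (hf : ∀ w, w ≠ r → f w ≠ w) {w : V} (hw : w ≠ r) :
    (parentGraph r f).Adj w (f w) := by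
  rw [parentGraph, SimpleGraph.fromRel_adj]
  exact ⟨(hf w hw).symm, Or.inl ⟨hw, rfl⟩⟩

theorem ReachesRoot.connected {r : V} {f : V → V} (hf : ∀ w, w ≠ r → f w ≠ w)
    (h : ReachesRoot r f) : (parentGraph r f).Connected := by
  have key : ∀ k w, f^[k] w = r → (parentGraph r f).Reachable w r := by
    intro k
    induction k with
    | zero => intro w hw; rw [show w = r from hw]
    | succ k ih =>
      intro w hw
      by_cases hwr : w = r
      · rw [hwr]
      · exact (parentGraph_adj hf hwr).reachable.trans (ih (f w) hw)
  have : Nonempty V := ⟨r⟩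
  refine ⟨fun u v => ?_⟩
  obtain ⟨k, hk⟩ := h u
  obtain ⟨l, hl⟩ := h v
  exact (key k u hk).trans (key l v hl).symm

/-- Every edge is `{w, f w}` for some `w ≠ r`, so a connected graph with at most `|V| - 1` edges
results. -/
theorem ReachesRoot.isTree [Finite V] {r : V} {f : V → V} (hf : ∀ w, w ≠ r → f w ≠ w)
    (h : ReachesRoot r f) : (parentGraph r f).IsTree := by
  classical
  have := Fintype.ofFinite V
  have hc := h.connected hf
  refine isTree_iff_connected_and_card.2 ⟨hc, le_antisymm ?_ hc.card_vert_le_card_edgeSet_add_one⟩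
  have hsub : (parentGraph r f).edgeFinset ⊆
      (Finset.univ.erase r).image fun w => s(w, f w) := by
    intro e he
    induction e with
    | _ u v =>
      rw [mem_edgeFinset, mem_edgeSet, parentGraph, SimpleGraph.fromRel_adj] at he
      obtain ⟨-, ⟨h1, rfl⟩ | ⟨h1, rfl⟩⟩ := he
      · exact Finset.mem_image.2 ⟨u, by simp [h1], rfl⟩
      · exact Finset.mem_image.2 ⟨v, by simp [h1], Sym2.eq_swap⟩
  have hle := (Finset.card_le_card hsub).trans Finset.card_image_le
  rw [Finset.card_erase_of_mem (Finset.mem_univ r), Finset.card_univ] at hle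
  have hpos : 0 < Fintype.card V := Fintype.card_pos_iff.2 ⟨r⟩
  rw [Nat.card_eq_fintype_card, Nat.card_eq_fintype_card, ← edgeFinset_card]
  omega

theorem parentGraph_injective {r : V} {f g : V → V} (hfr : f r = r) (hgr : g r = r)
    (hf : ∀ w, w ≠ r → f w ≠ w) (h : ReachesRoot r f)
    (hfg : parentGraph r f = parentGraph r g) : f = g := by
  have key : ∀ k w, f^[k] w = r → f w = g w := by
    intro k
    induction k with
    | zero => intro w hw; rw [show w = r from hw, hfr, hgr]
    | succ k ih =>
      intro w hw
      by_cases hwr : w = r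
      · rw [hwr, hfr, hgr]
      have hu := ih (f w) hw
      have hadj := parentGraph_adj hf hwr
      rw [hfg, parentGraph, SimpleGraph.fromRel_adj] at hadj
      obtain ⟨hne, ⟨-, h1⟩ | ⟨h1, h2⟩⟩ := hadj
      · exact h1.symm
      · exfalso
        rw [← hu] at h2
        -- Here `f (f w) = w`: the orbit of `w` alternates between two vertices different from `r`
        -- and never reaches the root.
        have cyc : ∀ j, f^[j] w = w ∨ f^[j] w = f w := by
          intro j
          induction j with
          | zero => exact Or.inl rfl
          | succ j ihj =>
            rw [Function.iterate_succ_apply']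
            obtain e | e := ihj
            · right; rw [e]
            · left; rw [e, h2]
        obtain ⟨j, hj⟩ := h w
        obtain e | e := cyc j
        · exact hwr (e.symm.trans hj)
        · exact h1 (e.symm.trans hj)
  funext w
  obtain ⟨k, hk⟩ := h w
  exact key k w hk

/-- Let `f` step to a neighbour nearer to the root. Its graph is a connected subgraph of `T`, and
trees are minimal connected graphs. -/
theorem IsTree.exists_parentGraph_eq [Finite V] {T : SimpleGraph V} (hT : T.IsTree) (r : V) :
    ∃ f : V → V, f r = r ∧ (∀ w, w ≠ r → T.Adj w (f w)) ∧ ReachesRoot r f ∧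
      parentGraph r f = T := by
  classical
  have step : ∀ w, w ≠ r → ∃ x, T.Adj w x ∧ T.dist x r < T.dist w r := by
    intro w hw
    obtain ⟨p, hp⟩ := hT.connected.exists_walk_length_eq_dist w r
    cases p with
    | nil => exact absurd rfl hw
    | cons hadj q =>
      refine ⟨_, hadj, ?_⟩
      have := dist_le q
      rw [Walk.length_cons] at hp
      omega
  choose! g hg1 hg2 using step
  let f : V → V := fun w => if w = r then r else g w
  have hfr : f r = r := if_pos rfl
  have hfg : ∀ w, w ≠ r → f w = g w := fun w hw => if_neg hw
  have hfa : ∀ w, w ≠ r → T.Adj w (f w) := fun w hw => by rw [hfg w hw]; exact hg1 w hw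
  have hreach : ReachesRoot r f := by
    have key : ∀ m w, T.dist w r ≤ m → ∃ k, f^[k] w = r := by
      intro m
      induction m with
      | zero =>
        intro w hw
        exact ⟨0, (hT.connected.dist_eq_zero_iff).1 (Nat.le_zero.1 hw)⟩
      | succ m ih =>
        intro w hw
        by_cases hwr : w = r
        · exact ⟨0, hwr⟩
        · have := hg2 w hwr
          obtain ⟨k, hk⟩ := ih (f w) (by rw [hfg w hwr]; omega)
          exact ⟨k + 1, hk⟩
    exact fun w => key _ w le_rfl
  refine ⟨f, hfr, hfa, hreach, ?_⟩
  have hmin := isTree_iff_minimal_connected.1 hT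
  have hle := parentGraph_le hfa
  exact le_antisymm hle (hmin.2 (hreach.connected fun w hw => (hfa w hw).ne') hle)

/-- The functions that send the root to itself and any other vertex to one of its neighbours. -/
def parentFunctions [Fintype V] [DecidableEq V] (G : SimpleGraph V) [DecidableRel G.Adj]
    (r : V) : Finset (V → V) :=
  Fintype.piFinset fun w => if w = r then {r} else G.neighborFinset w

theorem mem_parentFunctions [Fintype V] [DecidableEq V] {G : SimpleGraph V} [DecidableRel G.Adj]
    {r : V} {f : V → V} :
    f ∈ G.parentFunctions r ↔ f r = r ∧ ∀ w, w ≠ r → G.Adj w (f w) := by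
  rw [parentFunctions, Fintype.mem_piFinset]
  constructor
  · intro h
    refine ⟨by simpa using h r, fun w hw => ?_⟩
    simpa [hw] using h w
  · rintro ⟨h1, h2⟩ w
    by_cases hw : w = r
    · subst hw; simpa using h1
    · simpa [hw] using h2 w hw

open Classical in
theorem numSpanningTrees_eq_card [Fintype V] [DecidableEq V] (G : SimpleGraph V)
    [DecidableRel G.Adj] (r : V) :
    numSpanningTrees G = ((G.parentFunctions r).filter (ReachesRoot r)).card := by
  rw [numSpanningTrees, ← Nat.card_eq_finsetCard, eq_comm]
  have hm : ∀ f : ((G.parentFunctions r).filter (ReachesRoot r) : Finset (V → V)),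
      (f.1 r = r ∧ ∀ w, w ≠ r → G.Adj w (f.1 w)) ∧ ReachesRoot r f.1 := fun f => by
    have := f.2
    rwa [Finset.mem_filter, mem_parentFunctions] at this
  refine Nat.card_eq_of_bijective (fun f => ⟨parentGraph r f.1, parentGraph_le (hm f).1.2,
    (hm f).2.isTree fun w hw => ((hm f).1.2 w hw).ne'⟩) ⟨?_, ?_⟩
  · intro f g hfg
    exact Subtype.ext (parentGraph_injective (hm f).1.1 (hm g).1.1
      (fun w hw => ((hm f).1.2 w hw).ne') (hm f).2 (congrArg Subtype.val hfg))
  · rintro ⟨T, hle, hT⟩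
    obtain ⟨f, h1, h2, h3, rfl⟩ := hT.exists_parentGraph_eq r
    exact ⟨⟨f, Finset.mem_filter.2 ⟨mem_parentFunctions.2 ⟨h1, fun w hw => hle (h2 w hw)⟩, h3⟩⟩, rfl⟩

end SimpleGraph

/-! ### Determinants attached to parent functions -/

namespace Matrix

variable {V : Type*} [Fintype V] [DecidableEq V]

theorem det_one_add_vecMulVec {R : Type*} [CommRing R] (u v : V → R) :
    (1 + vecMulVec u v).det = 1 + v ⬝ᵥ u := by
  rw [← det_one_add_replicateCol_mul_replicateRow (ι := Unit) u v, vecMulVec_eq Unit]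

/-- The characteristic polynomial differs from `X ^ |V|` by a nilpotent, which vanishes over `ℝ`;
evaluate at `1`. -/
theorem det_one_sub_of_isNilpotent {M : Matrix V V ℝ} (hM : IsNilpotent M) :
    (1 - M).det = 1 := by
  have h := (isNilpotent_charpoly_sub_pow_of_isNilpotent hM).eq_zero
  have h2 := eval_charpoly M 1
  rw [sub_eq_zero.1 h] at h2
  simpa using h2.symm

/-- The matrix with ones in the positions `(w, f w)`, for `w` different from the root `r`. -/
def parentMatrix (r : V) (f : V → V) : Matrix V V ℝ :=
  of fun w x => if w ≠ r ∧ f w = x then 1 else 0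

theorem parentMatrix_mulVec (r : V) (f : V → V) (x : V → ℝ) (w : V) :
    (parentMatrix r f *ᵥ x) w = if w = r then 0 else x (f w) := by
  by_cases hw : w = r <;> simp [parentMatrix, mulVec, dotProduct, hw]

/-- Each application moves one step along `f`, and the row of the root is zero, so a vertex at depth
`j` is killed by every power beyond `j`. -/
theorem isNilpotent_parentMatrix {r : V} {f : V → V} (h : SimpleGraph.ReachesRoot r f) :
    IsNilpotent (parentMatrix r f) := by
  have key : ∀ j w, f^[j] w = r → ∀ (m : ℕ) (x : V → ℝ), j < m →
      ((parentMatrix r f ^ m) *ᵥ x) w = 0 := by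
    intro j
    induction j with
    | zero =>
      intro w hw m x hm
      obtain ⟨k, rfl⟩ : ∃ k, m = k + 1 := ⟨m - 1, by omega⟩
      rw [pow_succ', ← mulVec_mulVec, parentMatrix_mulVec, if_pos (show w = r from hw)]
    | succ j ih =>
      intro w hw m x hm
      obtain ⟨k, rfl⟩ : ∃ k, m = k + 1 := ⟨m - 1, by omega⟩
      rw [pow_succ', ← mulVec_mulVec, parentMatrix_mulVec]
      split_ifs
      · rfl
      · exact ih (f w) hw k x (by omega)
  choose k hk using h
  refine ⟨Finset.univ.sup k + 1, ?_⟩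
  ext w x
  have := key (k w) w (hk w) (Finset.univ.sup k + 1) (Pi.single x 1)
    (Nat.lt_succ_of_le (Finset.le_sup (Finset.mem_univ w)))
  simpa using this

theorem det_one_sub_parentMatrix_of_not_reachesRoot {r : V} {f : V → V} (hr : f r = r)
    (h : ¬ SimpleGraph.ReachesRoot r f) : (1 - parentMatrix r f).det = 0 := by
  classical
  rw [← exists_mulVec_eq_zero_iff]
  have hstep : ∀ w, (∃ k, f^[k] (f w) = r) ↔ ∃ k, f^[k] w = r := by
    intro w
    constructor
    · rintro ⟨k, hk⟩
      exact ⟨k + 1, hk⟩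
    · rintro ⟨k, hk⟩
      refine ⟨k, ?_⟩
      rw [← Function.iterate_succ_apply, Function.iterate_succ_apply', hk, hr]
  -- Membership in the set of vertices that never reach the root is invariant under `f`, so its
  -- indicator is a kernel vector.
  refine ⟨fun w => if ∃ k, f^[k] w = r then 0 else 1, ?_, ?_⟩
  · intro h0
    refine h fun w => ?_
    by_contra hw
    simpa [hw] using congrFun h0 w
  · funext w
    rw [sub_mulVec, one_mulVec, Pi.sub_apply, parentMatrix_mulVec]
    by_cases hw : w = r
    · subst hw
      have : ∃ k, f^[k] w = w := ⟨0, rfl⟩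
      simp [this]
    · simp only [hw, if_false, hstep w, sub_self, Pi.zero_apply]

end Matrix

/-! ### The matrix-tree theorem -/

namespace SimpleGraph

open Matrix

variable {V : Type*} [Fintype V] [DecidableEq V]

theorem lapMatrix_apply_eq_sum (G : SimpleGraph V) [DecidableRel G.Adj] (w x : V) :
    G.lapMatrix ℝ w x =
      ∑ y ∈ G.neighborFinset w, ((if w = x then 1 else 0) - (if y = x then 1 else 0)) := by
  rw [Finset.sum_sub_distrib]
  by_cases h : w = x
  · subst h
    simp [lapMatrix, degMatrix]
  · simp [lapMatrix, degMatrix, h, adjMatrix_apply]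

/-- Row `w ≠ r` is the sum of `e_w - e_y` over the neighbours `y`. Multilinearity expands the
determinant over parent functions; those reaching the root contribute `1`, the others `0`. -/
theorem det_updateRow_lapMatrix (G : SimpleGraph V) [DecidableRel G.Adj] (r : V) :
    ((G.lapMatrix ℝ).updateRow r (Pi.single r 1)).det = numSpanningTrees G := by
  classical
  let g : V → V → V → ℝ := fun w y x =>
    (if w = x then 1 else 0) - (if w ≠ r ∧ y = x then 1 else 0)
  have h1 : ((G.lapMatrix ℝ).updateRow r (Pi.single r 1)) =
      fun w => ∑ y ∈ (if w = r then {r} else G.neighborFinset w), g w y := by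
    funext w x
    rw [Finset.sum_apply]
    by_cases hw : w = r
    · subst hw
      simp [g, Pi.single_apply, eq_comm]
    · rw [updateRow_ne hw, lapMatrix_apply_eq_sum]
      simp [g, hw]
  have h2 : ∀ f : V → V, (detRowAlternating (R := ℝ) (n := V)).toMultilinearMap
      (fun w => g w (f w)) = (1 - parentMatrix r f).det := by
    intro f
    change Matrix.det (fun w => g w (f w)) = _
    congr 1
  rw [h1]
  change (detRowAlternating (R := ℝ) (n := V)).toMultilinearMap _ = _
  rw [MultilinearMap.map_sum_finset, numSpanningTrees_eq_card G r, Finset.card_filter,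
    Nat.cast_sum]
  refine Finset.sum_congr rfl fun f hf => ?_
  rw [h2]
  split_ifs with h
  · rw [det_one_sub_of_isNilpotent (isNilpotent_parentMatrix h), Nat.cast_one]
  · rw [det_one_sub_parentMatrix_of_not_reachesRoot (mem_parentFunctions.1 hf).1 h, Nat.cast_zero]

theorem sum_lapMatrix_row (G : SimpleGraph V) [DecidableRel G.Adj] (w : V) :
    ∑ x, G.lapMatrix ℝ w x = 0 := by
  have := congrFun (G.lapMatrix_mulVec_const_eq_zero (R := ℝ)) w
  simpa [mulVec, dotProduct] using this

theorem sum_lapMatrix_col (G : SimpleGraph V) [DecidableRel G.Adj] (x : V) :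
    ∑ w, G.lapMatrix ℝ w x = 0 := by
  rw [← G.sum_lapMatrix_row x]
  exact Finset.sum_congr rfl fun w _ => (G.isSymm_lapMatrix (R := ℝ)).apply x w

/-- A form of Kirchhoff's matrix-tree theorem. -/
theorem det_lapMatrix_add_ones [Nonempty V] (G : SimpleGraph V) [DecidableRel G.Adj] :
    (G.lapMatrix ℝ + of fun _ _ => 1).det = (Fintype.card V : ℝ) ^ 2 * numSpanningTrees G := by
  obtain ⟨r⟩ := ‹Nonempty V›
  let e : V → ℝ := Pi.single r 1
  let L : Matrix V V ℝ := G.lapMatrix ℝ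
  let J : Matrix V V ℝ := of fun _ _ => 1
  change (L + J).det = _
  -- Row and column operations as rank-one updates. On the left, row `r` becomes the sum of all
  -- rows, that is `n` in every entry. On the right, the column operation turns row `r` into ones
  -- and keeps the rows of `L`; adding row `r` to the others, and `n - 1` times to itself, gives the
  -- same matrix. The factors have determinants `1`, `n`, `t(G)`, `n`.
  have hprod : (1 + vecMulVec e (1 - e)) * (L + J) =
      (1 + vecMulVec (1 + ((Fintype.card V : ℝ) - 2) • e) e) *
        (L.updateRow r e * (1 + vecMulVec 1 (1 - e))) := by
    have hr : ∀ (u v : V → ℝ) (M : Matrix V V ℝ) (i j : V),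
        ((1 + vecMulVec u v) * M : Matrix V V ℝ) i j = M i j + u i * ∑ k, v k * M k j := by
      intro u v M i j
      rw [add_mul, one_mul, Matrix.add_apply, mul_apply]
      simp [vecMulVec_apply, Finset.mul_sum, mul_assoc]
    have hl : ∀ i j, (L.updateRow r e * (1 + vecMulVec 1 (1 - e)) : Matrix V V ℝ) i j =
        if i = r then 1 else L i j := by
      intro i j
      have : (L.updateRow r e * (1 + vecMulVec 1 (1 - e)) : Matrix V V ℝ) i j =
          L.updateRow r e i j + (∑ k, L.updateRow r e i k) * (1 - e j) := by
        rw [mul_add, mul_one, Matrix.add_apply, mul_apply]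
        simp [vecMulVec_apply, Finset.sum_mul]
      rw [this]
      split_ifs with hi
      · subst hi
        simp [e]
      · simp [hi, L, sum_lapMatrix_row]
    ext i j
    rw [hr, hr]
    simp only [hl]
    have h1 : ∑ k, (1 - e) k * (L + J) k j =
        (Fintype.card V : ℝ) - (L r j + 1) := by
      simp only [Pi.sub_apply, Pi.one_apply, sub_mul, one_mul, Finset.sum_sub_distrib, Matrix.add_apply,
        Finset.sum_add_distrib]
      simp [e, L, J, sum_lapMatrix_col, Pi.single_apply]
    have h2 : ∑ k, e k * (if k = r then 1 else L k j) = 1 := by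
      rw [Finset.sum_eq_single r (fun k _ hk => by simp [e, hk]) (by simp)]
      simp [e]
    have hJ : J i j = 1 := rfl
    rw [h1, h2, Matrix.add_apply, hJ]
    by_cases hi : i = r
    · subst hi
      simp [e]
      ring
    · simp [e, hi]
  have hdet := congrArg det hprod
  rw [det_mul, det_mul, det_mul, det_one_add_vecMulVec, det_one_add_vecMulVec,
    det_one_add_vecMulVec, det_updateRow_lapMatrix] at hdet
  have h1 : 1 + (1 - e) ⬝ᵥ e = 1 := by simp [e]
  have h2 : 1 + e ⬝ᵥ (1 + ((Fintype.card V : ℝ) - 2) • e) = Fintype.card V := by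
    simp [e]; ring
  have h3 : 1 + (1 - e) ⬝ᵥ (1 : V → ℝ) = Fintype.card V := by
    simp [e, sub_dotProduct]
  rw [h1, h2, h3, one_mul] at hdet
  rw [hdet]
  ring

end SimpleGraph

/-! ### Resistance distance and Kirchhoff index through `(L + J)⁻¹` -/

namespace SimpleGraph

open Matrix

section

variable {V : Type*} [Fintype V] [DecidableEq V] (G : SimpleGraph V) [DecidableRel G.Adj]

theorem lapMatrix_add_ones_mulVec (x : V → ℝ) :
    (G.lapMatrix ℝ + of fun _ _ => 1) *ᵥ x = G.lapMatrix ℝ *ᵥ x + fun _ => ∑ w, x w := by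
  rw [add_mulVec]
  congr 1
  funext w
  simp [mulVec, dotProduct]

theorem sum_lapMatrix_mulVec (x : V → ℝ) : ∑ w, (G.lapMatrix ℝ *ᵥ x) w = 0 := by
  simp only [mulVec, dotProduct]
  rw [Finset.sum_comm]
  simp [← Finset.sum_mul, sum_lapMatrix_col]

/-- Summing the coordinates of `(L + J) φ = e_u - e_v` gives `∑ φ = 0`, so `J φ = 0` and `L φ = e_u
- e_v`. -/
theorem isUnitCurrentPotential_inv_mulVec {u v : V}
    (h : IsUnit (G.lapMatrix ℝ + of fun _ _ => 1 : Matrix V V ℝ).det) :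
    IsUnitCurrentPotential G u v
      ((G.lapMatrix ℝ + of fun _ _ => 1)⁻¹ *ᵥ (Pi.single u 1 - Pi.single v 1)) := by
  set φ : V → ℝ := (G.lapMatrix ℝ + of fun _ _ => 1)⁻¹ *ᵥ (Pi.single u 1 - Pi.single v 1) with hφ
  have h1 : G.lapMatrix ℝ *ᵥ φ + (fun _ => ∑ w, φ w) = Pi.single u 1 - Pi.single v 1 := by
    rw [← lapMatrix_add_ones_mulVec, hφ, mulVec_mulVec, mul_nonsing_inv _ h, one_mulVec]
  have h2 : (Fintype.card V : ℝ) * ∑ w, φ w = 0 := by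
    have := congrArg (fun f : V → ℝ => ∑ w, f w) h1
    simpa [Finset.sum_add_distrib, sum_lapMatrix_mulVec] using this
  have h3 : ∑ w, φ w = 0 := by
    have : (Fintype.card V : ℝ) ≠ 0 := by
      have : Nonempty V := ⟨u⟩
      exact_mod_cast Fintype.card_ne_zero
    exact (mul_eq_zero.1 h2).resolve_left this
  intro w
  have h4 := congrFun h1 w
  rw [Pi.add_apply, h3, add_zero, lapMatrix_mulVec_apply] at h4
  rw [Finset.sum_sub_distrib, Finset.sum_const, nsmul_eq_mul, card_neighborFinset_eq_degree, h4]
  simp [Pi.single_apply]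

theorem resistanceDistance_eq_inv (u v : V)
    (h : IsUnit (G.lapMatrix ℝ + of fun _ _ => 1 : Matrix V V ℝ).det) :
    resistanceDistance G u v =
      (G.lapMatrix ℝ + of fun _ _ => 1 : Matrix V V ℝ)⁻¹ u u
        - (G.lapMatrix ℝ + of fun _ _ => 1 : Matrix V V ℝ)⁻¹ u v
        - (G.lapMatrix ℝ + of fun _ _ => 1 : Matrix V V ℝ)⁻¹ v u
        + (G.lapMatrix ℝ + of fun _ _ => 1 : Matrix V V ℝ)⁻¹ v v := by
  rw [(G.isUnitCurrentPotential_inv_mulVec (u := u) (v := v) h).resistanceDistance_eq]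
  simp only [mulVec_sub, Pi.sub_apply, mulVec_single_one, col_apply]
  ring

theorem sum_inv_lapMatrix_add_ones [Nonempty V]
    (h : IsUnit (G.lapMatrix ℝ + of fun _ _ => 1 : Matrix V V ℝ).det) :
    ∑ u, ∑ v, (G.lapMatrix ℝ + of fun _ _ => 1 : Matrix V V ℝ)⁻¹ u v = 1 := by
  set A : Matrix V V ℝ := G.lapMatrix ℝ + of fun _ _ => 1 with hA
  have hn : (Fintype.card V : ℝ) ≠ 0 := by exact_mod_cast Fintype.card_ne_zero
  have h1 : A *ᵥ (fun _ => 1) = (Fintype.card V : ℝ) • fun _ => 1 := by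
    rw [hA, lapMatrix_add_ones_mulVec, lapMatrix_mulVec_const_eq_zero]
    funext w
    simp
  have h2 : (Fintype.card V : ℝ) • (A⁻¹ *ᵥ fun _ => 1) = fun _ => 1 := by
    rw [← mulVec_smul, ← h1, mulVec_mulVec, nonsing_inv_mul _ h, one_mulVec]
  have h3 := congrArg (fun f : V → ℝ => ∑ w, f w) h2
  simp only [Pi.smul_apply, smul_eq_mul, ← Finset.mul_sum, Finset.sum_const, nsmul_eq_mul, mul_one,
    mulVec, dotProduct, Finset.card_univ] at h3
  exact mul_left_cancel₀ hn (h3.trans (mul_one _).symm)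

end

theorem two_mul_sum_sum_Ioi {n : ℕ} (F : Fin n → Fin n → ℝ) (hs : ∀ i j, F i j = F j i)
    (hd : ∀ i, F i i = 0) : 2 * ∑ i, ∑ j ∈ Finset.Ioi i, F i j = ∑ i, ∑ j, F i j := by
  have h1 : ∀ i, ∑ j, F i j = ∑ j, (if i < j then F i j else 0) + ∑ j, if j < i then F i j else 0 := by
    intro i
    rw [← Finset.sum_add_distrib]
    refine Finset.sum_congr rfl fun j _ => ?_
    rcases lt_trichotomy i j with h | h | h
    · simp [h, h.not_gt]
    · subst h; simp [hd]
    · simp [h, h.not_gt]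
  have h2 : ∀ i, ∑ j ∈ Finset.Ioi i, F i j = ∑ j, if i < j then F i j else 0 := by
    intro i
    rw [← Finset.sum_filter]
    congr 1
    ext j
    simp
  rw [Finset.sum_congr rfl fun i _ => h1 i, Finset.sum_congr rfl fun i _ => h2 i,
    Finset.sum_add_distrib, two_mul]
  congr 1
  rw [Finset.sum_comm]
  refine Finset.sum_congr rfl fun i _ => Finset.sum_congr rfl fun j _ => ?_
  rw [hs]

/-- Over all ordered pairs, the diagonal terms of the resistance formula add up to twice `n` times
the trace. Each off-diagonal family sums to `1`, because the all-ones vector is an eigenvector of `L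
+ J` for `n`. -/
theorem kirchhoffIndex_eq_trace_inv {n : ℕ} [NeZero n] (G : SimpleGraph (Fin n))
    [DecidableRel G.Adj]
    (h : IsUnit (G.lapMatrix ℝ + of fun _ _ => 1 : Matrix (Fin n) (Fin n) ℝ).det) :
    kirchhoffIndex G =
      n * (G.lapMatrix ℝ + of fun _ _ => 1 : Matrix (Fin n) (Fin n) ℝ)⁻¹.trace - 1 := by
  have h1 := G.sum_inv_lapMatrix_add_ones h
  have h2 := two_mul_sum_sum_Ioi (fun i j => resistanceDistance G i j)
    (fun i j => by rw [resistanceDistance_eq_inv G i j h, resistanceDistance_eq_inv G j i h]; ring)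
    (fun i => by rw [resistanceDistance_eq_inv G i i h]; ring)
  have h3 : ∑ i, ∑ j, (G.lapMatrix ℝ + of fun _ _ => 1 : Matrix (Fin n) (Fin n) ℝ)⁻¹ j i = 1 := by
    rw [Finset.sum_comm, h1]
  have h4 : ∑ i, ∑ j, resistanceDistance G i j =
      2 * (n * (G.lapMatrix ℝ + of fun _ _ => 1 : Matrix (Fin n) (Fin n) ℝ)⁻¹.trace - 1) := by
    simp only [resistanceDistance_eq_inv G _ _ h, Finset.sum_add_distrib, Finset.sum_sub_distrib,
      h1, h3, Finset.sum_const, Finset.card_univ, Fintype.card_fin, nsmul_eq_mul,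
      ← Finset.mul_sum, trace, diag_apply]
    ring
  rw [kirchhoffIndex]
  linarith

end SimpleGraph

/-! ### Spectral formulas for real symmetric matrices -/

namespace Matrix.IsHermitian

open Unitary

variable {V : Type*} [Fintype V] [DecidableEq V] {Q : Matrix V V ℝ} (hQ : Q.IsHermitian)

theorem eq_conj_diagonal_eigenvalues :
    Q = conjStarAlgAut ℝ _ hQ.eigenvectorUnitary (diagonal hQ.eigenvalues) :=
  hQ.spectral_theorem

theorem trace_conj_diagonal (g : V → ℝ) :
    (conjStarAlgAut ℝ _ hQ.eigenvectorUnitary (diagonal g)).trace = ∑ i, g i := by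
  rw [conjStarAlgAut_apply, trace_mul_comm, ← mul_assoc, Unitary.coe_star_mul_self, one_mul,
    trace_diagonal]

theorem smul_one_sub_eq_conj_diagonal (c : ℝ) :
    c • (1 : Matrix V V ℝ) - Q =
      conjStarAlgAut ℝ _ hQ.eigenvectorUnitary (diagonal fun i => c - hQ.eigenvalues i) := by
  have : (diagonal fun i => c - hQ.eigenvalues i) =
      c • (1 : Matrix V V ℝ) - diagonal hQ.eigenvalues := by
    rw [smul_one_eq_diagonal, diagonal_sub]
  rw [this, map_sub, map_smul, map_one, ← hQ.eq_conj_diagonal_eigenvalues]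

theorem det_smul_one_sub (c : ℝ) :
    (c • (1 : Matrix V V ℝ) - Q).det = ∏ i, (c - hQ.eigenvalues i) := by
  rw [hQ.smul_one_sub_eq_conj_diagonal c, conjStarAlgAut_apply, det_mul_comm, ← mul_assoc,
    Unitary.coe_star_mul_self, one_mul, det_diagonal]

theorem trace_inv_smul_one_sub {c : ℝ} (h : ∀ i, c - hQ.eigenvalues i ≠ 0) :
    (c • (1 : Matrix V V ℝ) - Q)⁻¹.trace = ∑ i, (c - hQ.eigenvalues i)⁻¹ := by
  rw [← hQ.trace_conj_diagonal]
  congr 1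
  refine inv_eq_right_inv ?_
  rw [hQ.smul_one_sub_eq_conj_diagonal c, ← map_mul, diagonal_mul_diagonal]
  simp [mul_inv_cancel₀ (h _)]

theorem trace_mul_self_eq_sum_sq_eigenvalues :
    (Q * Q).trace = ∑ i, hQ.eigenvalues i ^ 2 := by
  conv_lhs => rw [hQ.eq_conj_diagonal_eigenvalues, ← map_mul, diagonal_mul_diagonal,
    hQ.trace_conj_diagonal]
  simp [sq]

theorem dotProduct_mulVec_le {c : ℝ} (h : ∀ i, hQ.eigenvalues i ≤ c) (x : V → ℝ) :
    x ⬝ᵥ (Q *ᵥ x) ≤ c * (x ⬝ᵥ x) := by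
  have hpos : (c • (1 : Matrix V V ℝ) - Q).PosSemidef := by
    rw [hQ.smul_one_sub_eq_conj_diagonal c, conjStarAlgAut_apply]
    exact (PosSemidef.diagonal fun i => sub_nonneg.2 (h i)).mul_mul_conjTranspose_same _
  have := hpos.dotProduct_mulVec_nonneg x
  rw [star_trivial, sub_mulVec, smul_mulVec, one_mulVec, dotProduct_sub, dotProduct_smul,
    smul_eq_mul] at this
  linarith

theorem exists_mulVec_eq_smul (i : V) :
    ∃ x : V → ℝ, x ≠ 0 ∧ Q *ᵥ x = hQ.eigenvalues i • x := by
  refine ⟨hQ.eigenvectorBasis i, fun h => ?_, hQ.mulVec_eigenvectorBasis i⟩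
  refine hQ.eigenvectorBasis.orthonormal.ne_zero i ?_
  ext j
  exact congrFun h j

end Matrix.IsHermitian

/-! ### Laplacian eigenvalues of a graph with few edges -/

namespace SimpleGraph

open Matrix

variable {V : Type*} [Fintype V] [DecidableEq V] (G : SimpleGraph V) [DecidableRel G.Adj]

theorem lapMatrix_add_ones_eq :
    (G.lapMatrix ℝ + of fun _ _ => 1 : Matrix V V ℝ) =
      (Fintype.card V : ℝ) • 1 - Gᶜ.lapMatrix ℝ := by
  ext i j
  by_cases h : i = j
  · subst h
    have h1 : Gᶜ.degree i + G.degree i + 1 = Fintype.card V := by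
      have := G.degree_lt_card_verts i
      rw [degree_compl]
      omega
    have h2 : (Gᶜ.degree i : ℝ) + G.degree i + 1 = Fintype.card V := by exact_mod_cast h1
    simp [lapMatrix, degMatrix, ← h2]
    ring
  · by_cases h' : G.Adj i j <;> simp [lapMatrix, degMatrix, h, adjMatrix_apply, h', compl_adj]

theorem trace_lapMatrix : (G.lapMatrix ℝ).trace = 2 * (G.edgeFinset.card : ℝ) := by
  have := G.sum_degrees_eq_twice_card_edges
  have h : (∑ v, (G.degree v : ℝ)) = 2 * (G.edgeFinset.card : ℝ) := by exact_mod_cast this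
  rw [← h]
  simp [lapMatrix, degMatrix, trace]

theorem trace_lapMatrix_mul_self :
    (G.lapMatrix ℝ * G.lapMatrix ℝ).trace = ∑ v, ((G.degree v : ℝ) ^ 2 + G.degree v) := by
  rw [trace]
  refine Finset.sum_congr rfl fun v _ => ?_
  rw [diag_apply, mul_apply, ← Finset.add_sum_erase _ _ (Finset.mem_univ v)]
  congr 1
  · simp [lapMatrix, degMatrix, sq]
  · rw [degree_eq_sum_if_adj, ← Finset.add_sum_erase _ _ (Finset.mem_univ v)]
    simp only [SimpleGraph.irrefl, if_false, zero_add]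
    refine Finset.sum_congr rfl fun x hx => ?_
    have hx' := (Finset.mem_erase.1 hx).1
    simp [lapMatrix, degMatrix, adjMatrix_apply, hx', hx'.symm, G.adj_comm x v]
    split_ifs <;> simp

theorem lapMatrix_mulVec_apply_eq_sum (x : V → ℝ) (w : V) :
    (G.lapMatrix ℝ *ᵥ x) w = ∑ y ∈ G.neighborFinset w, (x w - x y) := by
  rw [lapMatrix_mulVec_apply, Finset.sum_sub_distrib, Finset.sum_const, nsmul_eq_mul,
    card_neighborFinset_eq_degree]

/-- The Laplacian kills every vector whose differences along edges vanish. The orientation picked by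
`out` is arbitrary and only affects signs. -/
theorem rank_lapMatrix_le : (G.lapMatrix ℝ).rank ≤ G.edgeFinset.card := by
  classical
  let D : (V → ℝ) →ₗ[ℝ] (G.edgeFinset → ℝ) :=
    { toFun := fun x e => x (e.1.out).1 - x (e.1.out).2
      map_add' := fun x y => by funext e; simp only [Pi.add_apply]; ring
      map_smul' := fun c x => by
        funext e; simp only [Pi.smul_apply, smul_eq_mul, RingHom.id_apply]; ring }
  have hker : LinearMap.ker D ≤ LinearMap.ker (G.lapMatrix ℝ).mulVecLin := by
    intro x hx
    rw [LinearMap.mem_ker, mulVecLin_apply, lapMatrix_mulVec_eq_zero_iff_forall_adj]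
    intro i j hij
    have hD : x (s(i, j).out).1 - x (s(i, j).out).2 = 0 :=
      congrFun (LinearMap.mem_ker.1 hx) ⟨s(i, j), mem_edgeFinset.2 hij⟩
    have hout : s((s(i, j).out).1, (s(i, j).out).2) = s(i, j) := Quot.out_eq s(i, j)
    rw [Sym2.eq_iff] at hout
    obtain ⟨h1, h2⟩ | ⟨h1, h2⟩ := hout
    · rw [h1, h2] at hD; linarith
    · rw [h1, h2] at hD; linarith
  have h1 := LinearMap.finrank_range_add_finrank_ker D
  have h2 := LinearMap.finrank_range_add_finrank_ker (G.lapMatrix ℝ).mulVecLin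
  have h3 := Submodule.finrank_mono hker
  have h4 := Submodule.finrank_le (LinearMap.range D)
  rw [Module.finrank_fintype_fun_eq_card, Fintype.card_coe] at h4
  rw [Matrix.rank]
  omega

variable {G}

theorem degree_add_degree_le {u v : V} (h : G.Adj u v) :
    G.degree u + G.degree v ≤ G.edgeFinset.card + 1 := by
  rw [← card_incidenceFinset_eq_degree, ← card_incidenceFinset_eq_degree,
    ← Finset.card_union_add_card_inter]
  refine Nat.add_le_add (Finset.card_le_card (Finset.union_subset (G.incidenceFinset_subset u)
    (G.incidenceFinset_subset v))) ?_
  have : Nonempty (Sym2 V) := ⟨s(u, v)⟩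
  rw [Finset.card_le_one_iff_subset_singleton]
  refine ⟨s(u, v), fun e he => ?_⟩
  rw [Finset.mem_inter, mem_incidenceFinset, mem_incidenceFinset] at he
  exact Finset.mem_singleton.2 ((Sym2.mem_and_mem_iff h.ne).1 ⟨he.1.2, he.2.2⟩)

theorem mem_or_mem_of_degree_add_degree {u v : V} (h : G.Adj u v)
    (hd : G.edgeFinset.card + 1 ≤ G.degree u + G.degree v) {e : Sym2 V} (he : e ∈ G.edgeFinset) :
    u ∈ e ∨ v ∈ e := by
  rw [← card_incidenceFinset_eq_degree, ← card_incidenceFinset_eq_degree,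
    ← Finset.card_union_add_card_inter] at hd
  have hle : (G.incidenceFinset u ∩ G.incidenceFinset v).card ≤ 1 := by
    have : Nonempty (Sym2 V) := ⟨s(u, v)⟩
    rw [Finset.card_le_one_iff_subset_singleton]
    refine ⟨s(u, v), fun e he => ?_⟩
    rw [Finset.mem_inter, mem_incidenceFinset, mem_incidenceFinset] at he
    exact Finset.mem_singleton.2 ((Sym2.mem_and_mem_iff h.ne).1 ⟨he.1.2, he.2.2⟩)
  have heq := Finset.eq_of_subset_of_card_le (Finset.union_subset (G.incidenceFinset_subset u)
    (G.incidenceFinset_subset v)) (by omega)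
  rw [← heq, Finset.mem_union, mem_incidenceFinset, mem_incidenceFinset] at he
  exact he.imp (·.2) (·.2)

/-- An eigenvector of the Laplacian for a nonzero eigenvalue attains its steepest descent along
some edge. -/
theorem exists_steepest_edge {μ : ℝ} (hμ : μ ≠ 0) {x : V → ℝ} (hx : x ≠ 0)
    (hQ : G.lapMatrix ℝ *ᵥ x = μ • x) :
    ∃ u v, G.Adj u v ∧ 0 < x u - x v ∧ ∀ a b, G.Adj a b → x a - x b ≤ x u - x v := by
  have hex : ∃ i j, G.Adj i j ∧ x i ≠ x j := by
    by_contra! hcon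
    rw [(lapMatrix_mulVec_eq_zero_iff_forall_adj G).2 hcon] at hQ
    exact (smul_ne_zero hμ hx) hQ.symm
  obtain ⟨i, j, hij, hne⟩ := hex
  have hs : ((Finset.univ : Finset (V × V)).filter fun q => G.Adj q.1 q.2).Nonempty :=
    ⟨(i, j), by simpa using hij⟩
  obtain ⟨⟨u, v⟩, huv, hmax⟩ := Finset.exists_max_image _ (fun q => x q.1 - x q.2) hs
  have hmax' : ∀ a b, G.Adj a b → x a - x b ≤ x u - x v := fun a b hab =>
    hmax (a, b) (by simpa using hab)
  refine ⟨u, v, by simpa using huv, ?_, hmax'⟩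
  have h1 := hmax' i j hij
  have h2 := hmax' j i hij.symm
  rcases lt_or_gt_of_ne hne with h | h <;> linarith

/-- Subtracting the eigenvalue equations at `u` and `v` writes `(deg u + deg v - μ)(x u - x v)` as a
sum of nonnegative shortfalls from the steepest descent. -/
theorem le_degree_add_degree_of_steepest {μ : ℝ} {x : V → ℝ}
    (hQ : G.lapMatrix ℝ *ᵥ x = μ • x) {u v : V} (hpos : 0 < x u - x v)
    (hmax : ∀ a b, G.Adj a b → x a - x b ≤ x u - x v) :
    μ ≤ G.degree u + G.degree v ∧
      ((G.degree u + G.degree v : ℝ) ≤ μ →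
        (∀ w, G.Adj u w → x u - x w = x u - x v) ∧ ∀ w, G.Adj v w → x w - x v = x u - x v) := by
  have hu := congrFun hQ u
  have hv := congrFun hQ v
  rw [lapMatrix_mulVec_apply_eq_sum, Pi.smul_apply, smul_eq_mul] at hu hv
  have hsum : ∑ w ∈ G.neighborFinset u, ((x u - x v) - (x u - x w)) +
      ∑ w ∈ G.neighborFinset v, ((x u - x v) - (x w - x v)) =
        (G.degree u + G.degree v - μ) * (x u - x v) := by
    have h1 : ∑ w ∈ G.neighborFinset v, (x w - x v) = - (μ * x v) := by
      rw [← hv, ← Finset.sum_neg_distrib]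
      exact Finset.sum_congr rfl fun w _ => by ring
    rw [Finset.sum_sub_distrib (fun _ => x u - x v) (fun w => x u - x w),
      Finset.sum_sub_distrib (fun _ => x u - x v) (fun w => x w - x v), hu, h1]
    simp only [Finset.sum_const, nsmul_eq_mul, card_neighborFinset_eq_degree]
    ring
  have hnu : ∀ w ∈ G.neighborFinset u, 0 ≤ (x u - x v) - (x u - x w) := fun w hw =>
    sub_nonneg.2 (hmax u w (by simpa using hw))
  have hnv : ∀ w ∈ G.neighborFinset v, 0 ≤ (x u - x v) - (x w - x v) := fun w hw =>
    sub_nonneg.2 (hmax w v (G.adj_symm (by simpa using hw)))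
  have h1 := Finset.sum_nonneg hnu
  have h2 := Finset.sum_nonneg hnv
  refine ⟨?_, fun hle => ⟨fun w hw => ?_, fun w hw => ?_⟩⟩
  · by_contra hlt
    have := mul_neg_of_neg_of_pos (sub_neg.2 (not_le.1 hlt)) hpos
    linarith
  · have h3 : ∑ w ∈ G.neighborFinset u, ((x u - x v) - (x u - x w)) = 0 := by
      have := mul_nonpos_of_nonpos_of_nonneg (sub_nonpos.2 hle) hpos.le
      linarith
    have := (Finset.sum_eq_zero_iff_of_nonneg hnu).1 h3 w (by simpa using hw)
    linarith
  · have h3 : ∑ w ∈ G.neighborFinset v, ((x u - x v) - (x w - x v)) = 0 := by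
      have := mul_nonpos_of_nonpos_of_nonneg (sub_nonpos.2 hle) hpos.le
      linarith
    have := (Finset.sum_eq_zero_iff_of_nonneg hnv).1 h3 w (by simpa using hw)
    linarith

/-- A nonzero Laplacian eigenvalue of a graph is at most the number of edges plus one. -/
theorem eigenvalue_le_card_edges_add_one {μ : ℝ} (hμ : μ ≠ 0) {x : V → ℝ} (hx : x ≠ 0)
    (hQ : G.lapMatrix ℝ *ᵥ x = μ • x) : μ ≤ G.edgeFinset.card + 1 := by
  obtain ⟨u, v, huv, hpos, hmax⟩ := exists_steepest_edge hμ hx hQ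
  have h1 := (le_degree_add_degree_of_steepest hQ hpos hmax).1
  have h2 : (G.degree u + G.degree v : ℝ) ≤ G.edgeFinset.card + 1 := by
    exact_mod_cast degree_add_degree_le huv
  linarith

/-- If the number of edges plus one is a Laplacian eigenvalue, all edges share a vertex. -/
theorem exists_degree_eq_card_edges {x : V → ℝ} (hx : x ≠ 0)
    (hQ : G.lapMatrix ℝ *ᵥ x = ((G.edgeFinset.card : ℝ) + 1) • x) :
    ∃ c, G.degree c = G.edgeFinset.card := by
  obtain ⟨u, v, huv, hpos, hmax⟩ := exists_steepest_edge (by positivity) hx hQ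
  have hkey := le_degree_add_degree_of_steepest hQ hpos hmax
  have hle := degree_add_degree_le huv
  have hge : G.edgeFinset.card + 1 ≤ G.degree u + G.degree v := by exact_mod_cast hkey.1
  obtain ⟨hNu, hNv⟩ := hkey.2 (by exact_mod_cast hle)
  have hdu : 0 < G.degree u := (G.degree_pos_iff_exists_adj _).2 ⟨v, huv⟩
  have hdv : 0 < G.degree v := (G.degree_pos_iff_exists_adj _).2 ⟨u, huv.symm⟩
  -- Otherwise `u` and `v` have further neighbours `w` and `z`. The edge `uw` is also steepest, so
  -- its degree sum forces `vz` to meet it, hence `w = z`; then `x` drops by the maximum twice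
  -- between `u` and `v`.
  by_contra! hne
  have hu1 : 1 < G.degree u := by
    have := hne v
    omega
  have hv1 : 1 < G.degree v := by
    have := hne u
    omega
  rw [← card_neighborFinset_eq_degree] at hu1 hv1
  obtain ⟨w, hw, hwv⟩ := Finset.exists_mem_ne hu1 v
  obtain ⟨z, hz, hzu⟩ := Finset.exists_mem_ne hv1 u
  rw [mem_neighborFinset] at hw hz
  have e1 := hNu w hw
  have e2 := hNv z hz
  have h3 := (le_degree_add_degree_of_steepest hQ (u := u) (v := w) (by rw [e1]; exact hpos)
    (by rw [e1]; exact hmax)).1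
  rcases mem_or_mem_of_degree_add_degree hw (by exact_mod_cast h3)
    (mem_edgeFinset.2 (show s(v, z) ∈ G.edgeSet from hz)) with h | h <;> rw [Sym2.mem_iff] at h
  · rcases h with h | h
    · exact huv.ne h
    · exact hzu h.symm
  · rcases h with h | h
    · exact hwv h
    · rw [← h] at e2
      linarith

/-- Every positive degree is less than the largest Laplacian eigenvalue. -/
theorem degree_add_one_le_of_eigenvalues_le {M : ℝ}
    (hM : ∀ i, (G.isHermitian_lapMatrix ℝ).eigenvalues i ≤ M) {c : V} (hc : 0 < G.degree c) :
    (G.degree c : ℝ) + 1 ≤ M := by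
  obtain ⟨d, hd⟩ : ∃ d : ℝ, d = (G.degree c : ℝ) := ⟨_, rfl⟩
  rw [← hd]
  have hdpos : 0 < d := by rw [hd]; exact_mod_cast hc
  -- Rayleigh test vector: the top eigenvector of the star formed by `c` and its neighbours.
  let x : V → ℝ := fun w => if w = c then d else if G.Adj c w then -1 else 0
  have hxc : x c = d := if_pos rfl
  have hxa : ∀ w, G.Adj c w → x w = -1 := fun w hw => by simp [x, hw, hw.ne']
  have hray := (G.isHermitian_lapMatrix ℝ).dotProduct_mulVec_le hM x
  have hxx : x ⬝ᵥ x = d * (d + 1) := by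
    have h1 : ∀ w, x w * x w = (if w = c then d ^ 2 else 0) + if G.Adj c w then 1 else 0 := by
      intro w
      by_cases hw : w = c
      · subst hw; simp [x, sq]
      · by_cases ha : G.Adj c w <;> simp [x, hw, ha]
    rw [dotProduct, Finset.sum_congr rfl fun w _ => h1 w, Finset.sum_add_distrib,
      ← degree_eq_sum_if_adj, ← hd]
    simp
    ring
  have hQx : d * (d + 1) ^ 2 ≤ x ⬝ᵥ (G.lapMatrix ℝ *ᵥ x) := by
    rw [← toLinearMap₂'_apply', lapMatrix_toLinearMap₂', le_div_iff₀ two_pos,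
      ← Finset.add_sum_erase _ _ (Finset.mem_univ c)]
    have h1 : ∑ j, (if G.Adj c j then (x c - x j) ^ 2 else 0) = d * (d + 1) ^ 2 := by
      have : ∀ j, (if G.Adj c j then (x c - x j) ^ 2 else 0) =
          (if G.Adj c j then 1 else 0) * (d + 1) ^ 2 := by
        intro j
        split_ifs with h
        · rw [hxc, hxa j h]; ring
        · ring
      rw [Finset.sum_congr rfl fun j _ => this j, ← Finset.sum_mul, ← degree_eq_sum_if_adj, ← hd]
    -- The quadratic form is half a sum over ordered pairs; this recovers the edges at `c` in
    -- reversed order.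
    have h2 : d * (d + 1) ^ 2 ≤ ∑ i ∈ Finset.univ.erase c,
        ∑ j, (if G.Adj i j then (x i - x j) ^ 2 else 0) := by
      rw [← h1, ← Finset.add_sum_erase _ _ (Finset.mem_univ c)]
      simp only [SimpleGraph.irrefl, if_false, zero_add]
      refine Finset.sum_le_sum fun i _ => ?_
      refine le_trans (le_of_eq ?_) (Finset.single_le_sum
        (f := fun j => if G.Adj i j then (x i - x j) ^ 2 else 0)
        (fun j _ => by positivity) (Finset.mem_univ c))
      simp only [G.adj_comm i c]
      split_ifs <;> ring
    linarith
  rw [hxx] at hray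
  have hpos : 0 < d * (d + 1) := by positivity
  refine le_of_mul_le_mul_right ?_ hpos
  calc (d + 1) * (d * (d + 1)) = d * (d + 1) ^ 2 := by ring
    _ ≤ _ := hQx.trans hray

end SimpleGraph

/-! ### Maclaurin's inequality -/

/-- The left side is the tangent to `t ^ (k + 1)` at `B`, evaluated at `A`; convexity puts it below
the curve. -/
theorem pow_mul_tangent_le_pow_succ {A B : ℝ} (hA : 0 ≤ A) (hB : 0 ≤ B) (k : ℕ) :
    B ^ k * ((k + 1) * A - k * B) ≤ A ^ (k + 1) := by
  induction k with
  | zero => simp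
  | succ k ih =>
    have h1 := mul_le_mul_of_nonneg_left ih hA
    have h2 : 0 ≤ B ^ k * ((k + 1) * (A - B) ^ 2) := by positivity
    calc B ^ (k + 1) * (((k + 1 : ℕ) + 1) * A - (k + 1 : ℕ) * B)
        = A * (B ^ k * ((k + 1) * A - k * B)) - B ^ k * ((k + 1) * (A - B) ^ 2) := by
          push_cast; ring
      _ ≤ A * A ^ (k + 1) := by linarith
      _ = A ^ (k + 1 + 1) := by ring

-- Both bounds go through one induction: split off `x a`, let `B` be the mean of the rest, so that
-- `x a = (k + 2) A - (k + 1) B`, and apply the tangent inequality.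
open Classical in
theorem prod_le_pow_and_sum_prod_erase_le {ι : Type*} (s : Finset ι) {x : ι → ℝ}
    (hx : ∀ i ∈ s, 0 ≤ x i) :
    ∀ A : ℝ, ∑ i ∈ s, x i = s.card * A → 0 ≤ A → ∏ i ∈ s, x i ≤ A ^ s.card ∧
      ∑ i ∈ s, ∏ j ∈ s.erase i, x j ≤ s.card * A ^ (s.card - 1) := by
  induction s using Finset.induction_on with
  | empty => intro A _ _; simp
  | insert a s ha ih =>
    intro A hsum hA
    have hxs : ∀ i ∈ s, 0 ≤ x i := fun i hi => hx i (Finset.mem_insert_of_mem hi)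
    have hxa : 0 ≤ x a := hx a (Finset.mem_insert_self a s)
    have hE : ∑ i ∈ insert a s, ∏ j ∈ (insert a s).erase i, x j =
        ∏ j ∈ s, x j + x a * ∑ i ∈ s, ∏ j ∈ s.erase i, x j := by
      rw [Finset.sum_insert ha, Finset.erase_insert ha, Finset.mul_sum]
      congr 1
      refine Finset.sum_congr rfl fun i hi => ?_
      have hai : a ≠ i := fun h => ha (h ▸ hi)
      rw [Finset.erase_insert_of_ne hai, Finset.prod_insert fun h => ha (Finset.mem_of_mem_erase h)]
    rw [hE, Finset.prod_insert ha, Finset.card_insert_of_notMem ha]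
    rw [Finset.sum_insert ha, Finset.card_insert_of_notMem ha] at hsum
    obtain rfl | hne := s.eq_empty_or_nonempty
    · simp at hsum ⊢
      exact hsum.le
    obtain ⟨k, hk⟩ : ∃ k, s.card = k + 1 := ⟨s.card - 1, by have := hne.card_pos; omega⟩
    obtain ⟨B, hB⟩ : ∃ B, B = (∑ i ∈ s, x i) / (k + 1) := ⟨_, rfl⟩
    have hk0 : (0 : ℝ) < k + 1 := by positivity
    have hB0 : 0 ≤ B := by rw [hB]; exact div_nonneg (Finset.sum_nonneg hxs) hk0.le
    have hSB : ∑ i ∈ s, x i = (k + 1) * B := by rw [hB]; field_simp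
    obtain ⟨hP, hS⟩ := ih hxs B (by rw [hk, hSB]; push_cast; ring) hB0
    rw [hk] at hP hS hsum ⊢
    rw [hSB] at hsum
    push_cast at hS hsum ⊢
    have hxe : x a = (k + 2) * A - (k + 1) * B := by linarith
    constructor
    · have h1 := pow_mul_tangent_le_pow_succ hA hB0 (k + 1)
      calc x a * ∏ i ∈ s, x i ≤ x a * B ^ (k + 1) := mul_le_mul_of_nonneg_left hP hxa
        _ = B ^ (k + 1) * (((k + 1 : ℕ) + 1) * A - (k + 1 : ℕ) * B) := by
          rw [hxe]; push_cast; ring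
        _ ≤ _ := h1
    · have h1 := pow_mul_tangent_le_pow_succ hA hB0 k
      have h2 := mul_le_mul_of_nonneg_left hS hxa
      have h3 := mul_le_mul_of_nonneg_left h1 (by positivity : (0 : ℝ) ≤ k + 2)
      calc _ ≤ B ^ (k + 1) + x a * ((k + 1) * B ^ k) := add_le_add hP h2
        _ = (k + 2) * (B ^ k * ((k + 1) * A - k * B)) := by rw [hxe]; ring
        _ ≤ (k + 2) * A ^ (k + 1) := h3
        _ = _ := by ring

open Classical in
/-- A case of Maclaurin's inequality for elementary symmetric polynomials. -/
theorem sum_prod_erase_le {ι : Type*} (s : Finset ι) {x : ι → ℝ} (hx : ∀ i ∈ s, 0 ≤ x i)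
    {c : ℝ} (hc : ∑ i ∈ s, x i ≤ s.card * c) :
    ∑ i ∈ s, ∏ j ∈ s.erase i, x j ≤ s.card * c ^ (s.card - 1) := by
  obtain rfl | hne := s.eq_empty_or_nonempty
  · simp
  have hpos : (0 : ℝ) < s.card := by exact_mod_cast hne.card_pos
  have hA0 : 0 ≤ (∑ i ∈ s, x i) / s.card := div_nonneg (Finset.sum_nonneg hx) hpos.le
  refine (prod_le_pow_and_sum_prod_erase_le s hx _ (by field_simp) hA0).2.trans ?_
  refine mul_le_mul_of_nonneg_left (pow_le_pow_left₀ hA0 ?_ _) hpos.le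
  rw [div_le_iff₀ hpos]
  linarith

/-! ### Stars and connectedness of the complement -/

namespace SimpleGraph

section

variable {V : Type*} [Fintype V] [DecidableEq V] {G : SimpleGraph V} [DecidableRel G.Adj]

theorem eq_or_eq_of_degree_eq_card_edges {c : V} (hc : G.degree c = G.edgeFinset.card) {u v : V}
    (h : G.Adj u v) : c = u ∨ c = v := by
  rw [← card_incidenceFinset_eq_degree] at hc
  have heq := Finset.eq_of_subset_of_card_le (G.incidenceFinset_subset c) hc.ge
  have he : s(u, v) ∈ G.incidenceFinset c := by rw [heq]; exact mem_edgeFinset.2 h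
  rw [mem_incidenceFinset] at he
  exact Sym2.mem_iff.1 he.2

theorem sum_sq_degree_of_degree_eq_card_edges {c : V} (hc : G.degree c = G.edgeFinset.card) :
    ∑ v, ((G.degree v : ℝ) ^ 2 + G.degree v) =
      (G.edgeFinset.card : ℝ) ^ 2 + 3 * G.edgeFinset.card := by
  have h1 : ∀ v ∈ Finset.univ.erase c, (G.degree v : ℝ) ^ 2 + G.degree v = 2 * G.degree v := by
    intro v hv
    have hle : G.degree v ≤ 1 := by
      rw [← card_neighborFinset_eq_degree]
      refine (Finset.card_le_card (t := {c}) fun x hx => ?_).trans (Finset.card_singleton c).le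
      rw [mem_neighborFinset] at hx
      rw [Finset.mem_singleton]
      exact ((eq_or_eq_of_degree_eq_card_edges hc hx).resolve_left
        (Finset.ne_of_mem_erase hv).symm).symm
    interval_cases G.degree v <;> norm_num
  have h2 : ∑ v, (G.degree v : ℝ) = 2 * G.edgeFinset.card := by
    exact_mod_cast G.sum_degrees_eq_twice_card_edges
  rw [← Finset.add_sum_erase _ _ (Finset.mem_univ c)] at h2
  rw [← Finset.add_sum_erase _ _ (Finset.mem_univ c), Finset.sum_congr rfl h1, ← Finset.mul_sum]
  rw [hc] at h2 ⊢
  linarith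

/-- If `u` and `v` are not adjacent in `G`, their neighbourhoods in `Gᶜ` cannot cover `V`; an
uncovered vertex is a common neighbour in `G`. -/
theorem connected_of_card_edges_compl_lt [Nonempty V]
    (h : Gᶜ.edgeFinset.card + 1 < Fintype.card V) : G.Connected := by
  refine ⟨fun u v => ?_⟩
  by_cases huv : u = v
  · rw [huv]
  by_cases hadj : G.Adj u v
  · exact hadj.reachable
  have hc : Gᶜ.Adj u v := (G.compl_adj u v).2 ⟨huv, hadj⟩
  have hlt : (Gᶜ.neighborFinset u ∪ Gᶜ.neighborFinset v).card < Fintype.card V := by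
    refine lt_of_le_of_lt (Finset.card_union_le _ _) ?_
    rw [card_neighborFinset_eq_degree, card_neighborFinset_eq_degree]
    exact (degree_add_degree_le hc).trans_lt h
  obtain ⟨w, hw⟩ : ∃ w, w ∉ Gᶜ.neighborFinset u ∪ Gᶜ.neighborFinset v := by
    by_contra! hall
    rw [Finset.eq_univ_iff_forall.2 hall, Finset.card_univ] at hlt
    exact lt_irrefl _ hlt
  rw [Finset.mem_union, mem_neighborFinset, mem_neighborFinset, not_or] at hw
  have hwu : w ≠ u := fun e => hw.2 (e ▸ hc.symm)
  have hwv : w ≠ v := fun e => hw.1 (e ▸ hc)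
  have h1 : G.Adj u w := by
    by_contra hn
    exact hw.1 ((G.compl_adj u w).2 ⟨hwu.symm, hn⟩)
  have h2 : G.Adj v w := by
    by_contra hn
    exact hw.2 ((G.compl_adj v w).2 ⟨hwv.symm, hn⟩)
  exact h1.reachable.trans h2.symm.reachable

theorem isCompleteMinus_star_iff :
    IsCompleteMinus G (completeBipartiteGraph (Fin 1) (Fin Gᶜ.edgeFinset.card)) ↔
      ∃ c, Gᶜ.degree c = Gᶜ.edgeFinset.card := by
  constructor
  · rintro ⟨f, ⟨g⟩⟩
    refine ⟨g.symm (f (Sum.inl 0)), ?_⟩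
    have hN : Gᶜ.neighborFinset (g.symm (f (Sum.inl 0))) =
        Finset.univ.image fun j => g.symm (f (Sum.inr j)) := by
      ext x
      rw [mem_neighborFinset, compl_adj, ← g.map_adj_iff, g.apply_symm_apply, sdiff_adj, top_adj,
        Finset.mem_image, ← g.injective.ne_iff, g.apply_symm_apply]
      have hiff : ((completeBipartiteGraph (Fin 1) (Fin Gᶜ.edgeFinset.card)).map f).Adj
          (f (Sum.inl 0)) (g x) ↔ ∃ j, f (Sum.inr j) = g x := by
        rw [SimpleGraph.map_adj]
        constructor
        · rintro ⟨a, b, hab, ha, hb⟩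
          rw [f.injective ha] at hab
          rcases b with b | b
          · simp at hab
          · exact ⟨b, hb⟩
        · rintro ⟨j, hj⟩
          exact ⟨Sum.inl 0, Sum.inr j, by simp, rfl, hj⟩
      rw [hiff]
      constructor
      · rintro ⟨h1, h2⟩
        obtain ⟨j, hj⟩ := not_not.1 fun h => h2 ⟨h1, h⟩
        exact ⟨j, Finset.mem_univ j, by rw [hj, g.symm_apply_apply]⟩
      · rintro ⟨j, -, rfl⟩
        rw [g.apply_symm_apply]
        refine ⟨fun h => ?_, fun h => h.2 ⟨j, rfl⟩⟩
        exact absurd (f.injective h) (by simp)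
    rw [← card_neighborFinset_eq_degree, hN, Finset.card_image_of_injective, Finset.card_univ,
      Fintype.card_fin]
    intro a b hab
    exact Sum.inr_injective (f.injective (g.symm.injective hab))
  · rintro ⟨c, hc⟩
    have hcard : (Gᶜ.neighborFinset c).card = Gᶜ.edgeFinset.card := by
      rw [card_neighborFinset_eq_degree, hc]
    let e := ((Gᶜ.neighborFinset c).equivFinOfCardEq hcard).symm
    have he : ∀ j, Gᶜ.Adj c (e j) := fun j => (mem_neighborFinset _ _ _).1 (e j).2
    let f : Fin 1 ⊕ Fin Gᶜ.edgeFinset.card ↪ V :=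
      ⟨Sum.elim (fun _ => c) fun j => (e j : V), by
        rintro (a | a) (b | b) hab
        · rw [Subsingleton.elim a b]
        · exact absurd hab (he b).ne
        · exact absurd hab (he a).ne'
        · exact congrArg Sum.inr (e.injective (Subtype.ext hab))⟩
    have hmap : (completeBipartiteGraph (Fin 1) (Fin Gᶜ.edgeFinset.card)).map f = Gᶜ := by
      ext u v
      rw [SimpleGraph.map_adj]
      constructor
      · rintro ⟨a | a, b | b, hab, rfl, rfl⟩
        · simp at hab
        · exact he b
        · exact (he a).symm
        · simp at hab
      · intro huv
        have hsurj : ∀ w, Gᶜ.Adj c w → ∃ j, (e j : V) = w := fun w hw =>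
          ⟨e.symm ⟨w, (mem_neighborFinset _ _ _).2 hw⟩, by rw [e.apply_symm_apply]⟩
        obtain rfl | rfl := eq_or_eq_of_degree_eq_card_edges hc huv
        · obtain ⟨j, hj⟩ := hsurj v huv
          exact ⟨Sum.inl 0, Sum.inr j, by simp, rfl, hj⟩
        · obtain ⟨j, hj⟩ := hsurj u huv.symm
          exact ⟨Sum.inr j, Sum.inl 0, by simp, hj, rfl⟩
    have hG : G = ⊤ \ (completeBipartiteGraph (Fin 1) (Fin Gᶜ.edgeFinset.card)).map f := by
      rw [hmap, top_sdiff, compl_compl]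
    exact ⟨f, ⟨hG ▸ Iso.refl⟩⟩

end

end SimpleGraph

/-! ### Spectral data of the complement -/

namespace SimpleGraph

open Matrix Finset

/-- Spectral data of the Laplacian of the complement of a graph on `n` vertices with `p` missing
edges: the values `n - μ` over the `p` largest eigenvalues `μ` of the complement, the smallest one
being `l` and the others `x i`, `i ∈ s`. -/
theorem exists_spectral_data {n p : ℕ} (hp : 2 ≤ p) (hpn : p ≤ n / 2) (G : SimpleGraph (Fin n))
    [DecidableRel G.Adj] (hcard : Gᶜ.edgeFinset.card = p) :
    ∃ (s : Finset (Fin n)) (x : Fin n → ℝ) (l : ℝ),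
      s.card = p - 1 ∧ (n : ℝ) - p - 1 ≤ l ∧ (∀ i ∈ s, 0 < x i) ∧ l ≤ G.minDegree ∧
      ∑ i ∈ s, x i ≤ s.card * ((n : ℝ) - 1) ∧
      (l = (n : ℝ) - p - 1 ↔ ∃ c, Gᶜ.degree c = p) ∧
      (l = (n : ℝ) - p - 1 → (G.minDegree : ℝ) = l ∧ ∀ i ∈ s, x i = n - 1) ∧
      (numSpanningTrees G : ℝ) = (n : ℝ) ^ (n - p - 2) * (l * ∏ i ∈ s, x i) ∧
      kirchhoffIndex G = n - 1 - p + n / l + n * ∑ i ∈ s, (x i)⁻¹ := by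
  classical
  have hn4 : 4 ≤ n := by omega
  have hexp : n - p = (n - p - 2) + 2 := by omega
  have : NeZero n := ⟨by omega⟩
  have hnp : (p : ℝ) + p ≤ n := by exact_mod_cast (by omega : p + p ≤ n)
  have hp2 : (2 : ℝ) ≤ p := by exact_mod_cast hp
  have hn0 : (0 : ℝ) < n := by linarith
  have hH := Gᶜ.isHermitian_lapMatrix ℝ
  obtain ⟨μ, hμ⟩ : ∃ μ, μ = hH.eigenvalues := ⟨_, rfl⟩
  have hle : ∀ i, μ i ≤ p + 1 := by
    intro i
    by_cases h0 : μ i = 0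
    · rw [h0]; linarith
    obtain ⟨v, hv, hQ⟩ := hH.exists_mulVec_eq_smul i
    rw [← hμ] at hQ
    have := eigenvalue_le_card_edges_add_one h0 hv hQ
    rwa [hcard] at this
  obtain ⟨i₁, -, hmax⟩ := exists_max_image univ μ ⟨0, mem_univ _⟩
  have hdeg : ∀ c, 0 < Gᶜ.degree c → (Gᶜ.degree c : ℝ) + 1 ≤ μ i₁ := fun c hc =>
    degree_add_one_le_of_eigenvalues_le (fun i => by
      have := hmax i (mem_univ i); rwa [hμ] at this ⊢) hc
  have hμ1 : 2 ≤ μ i₁ := by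
    obtain ⟨e, he⟩ : Gᶜ.edgeFinset.Nonempty := card_pos.1 (by omega)
    induction e with
    | _ u v =>
      have hd : 0 < Gᶜ.degree u :=
        (Gᶜ.degree_pos_iff_exists_adj u).2 ⟨v, mem_edgeFinset.1 he⟩
      have h1 : (1 : ℝ) ≤ Gᶜ.degree u := by exact_mod_cast hd
      linarith [hdeg u hd]
  have hrank : (univ.filter fun i => μ i ≠ 0).card ≤ p := by
    have h1 := Gᶜ.rank_lapMatrix_le
    rw [hH.rank_eq_card_non_zero_eigs, Fintype.card_subtype, hcard] at h1
    rwa [hμ]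
  -- Zero eigenvalues pad the nonzero ones to exactly `p` indices, so the formulas do not depend on
  -- the rank.
  obtain ⟨T, hT, hTcard⟩ := exists_superset_card_eq hrank (by rw [Fintype.card_fin]; omega)
  have hout : ∀ i ∉ T, μ i = 0 := fun i hi => by
    by_contra h
    exact hi (hT (by simpa using h))
  have hi₁ : i₁ ∈ T := by
    by_contra h
    have := hout _ h
    linarith
  have hTc : Tᶜ.card = n - p := by rw [card_compl, hTcard, Fintype.card_fin]
  have hscard : (T.erase i₁).card = p - 1 := by rw [card_erase_of_mem hi₁, hTcard]
  have hscast : ((T.erase i₁).card : ℝ) = p - 1 := by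
    rw [hscard, Nat.cast_sub (by omega), Nat.cast_one]
  have hpos : ∀ i, 0 < (n : ℝ) - μ i := fun i => by linarith [hle i]
  have hsumT : ∀ g : ℝ → ℝ, ∑ i, g (μ i) =
      (n - p : ℝ) * g 0 + (g (μ i₁) + ∑ i ∈ T.erase i₁, g (μ i)) := by
    intro g
    rw [add_sum_erase _ (fun i => g (μ i)) hi₁, ← sum_add_sum_compl T, add_comm,
      sum_congr rfl fun i hi => by rw [hout i (mem_compl.1 hi)], sum_const, hTc, nsmul_eq_mul,
      Nat.cast_sub (by omega)]
  have hsum : ∑ i ∈ T.erase i₁, μ i = 2 * p - μ i₁ := by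
    have h1 := hH.trace_eq_sum_eigenvalues
    rw [trace_lapMatrix, hcard, ← hμ] at h1
    have h2 := hsumT id
    simp only [id, mul_zero, zero_add] at h2
    have h1' : 2 * (p : ℝ) = ∑ i, μ i := by simpa using h1
    linarith
  have hA : (G.lapMatrix ℝ + of fun _ _ => 1 : Matrix (Fin n) (Fin n) ℝ) =
      (n : ℝ) • 1 - Gᶜ.lapMatrix ℝ := by
    rw [lapMatrix_add_ones_eq, Fintype.card_fin]
  have hdet : (G.lapMatrix ℝ + of fun _ _ => 1 : Matrix (Fin n) (Fin n) ℝ).det =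
      ∏ i, ((n : ℝ) - μ i) := by
    rw [hA, hH.det_smul_one_sub, hμ]
  have hmin : (n : ℝ) - μ i₁ ≤ G.minDegree := by
    obtain ⟨v, hv⟩ := G.exists_minimal_degree_vertex
    have h1 : G.degree v + Gᶜ.degree v + 1 = n := by
      have := G.degree_lt_card_verts v
      rw [degree_compl]
      rw [Fintype.card_fin] at this ⊢
      omega
    have h2 : (G.degree v : ℝ) + Gᶜ.degree v + 1 = n := by exact_mod_cast h1
    rw [hv]
    rcases Nat.eq_zero_or_pos (Gᶜ.degree v) with h0 | h0
    · rw [h0] at h2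
      push_cast at h2
      linarith
    · linarith [hdeg v h0]
  have hiff : (n : ℝ) - μ i₁ = n - p - 1 ↔ ∃ c, Gᶜ.degree c = p := by
    constructor
    · intro h
      obtain ⟨v, hv, hQ⟩ := hH.exists_mulVec_eq_smul i₁
      rw [← hμ, show μ i₁ = (Gᶜ.edgeFinset.card : ℝ) + 1 by rw [hcard]; linarith] at hQ
      obtain ⟨c, hc⟩ := exists_degree_eq_card_edges hv hQ
      exact ⟨c, hc.trans hcard⟩
    · rintro ⟨c, hc⟩
      have h1 := hdeg c (by omega)
      rw [hc] at h1
      linarith [hle i₁]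
  refine ⟨T.erase i₁, fun i => n - μ i, n - μ i₁, hscard, by linarith [hle i₁], fun i _ => hpos i,
    hmin, ?_, hiff, ?_, ?_, ?_⟩
  -- The sum is `(p - 1) n - 2p + μ₁`, so the bound amounts to `μ₁ ≤ p + 1`.
  · rw [sum_sub_distrib, hsum, sum_const, nsmul_eq_mul, hscast]
    linarith [hle i₁]
  · intro h
    obtain ⟨c, hc⟩ := hiff.1 h
    constructor
    · refine le_antisymm ?_ hmin
      have h1 : G.minDegree + p + 1 ≤ n := by
        have h2 := G.minDegree_le_degree c
        have h3 := G.degree_lt_card_verts c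
        rw [degree_compl] at hc
        rw [Fintype.card_fin] at hc h3
        omega
      have h2 : (G.minDegree : ℝ) + p + 1 ≤ n := by exact_mod_cast h1
      linarith
    · have h1 := hH.trace_mul_self_eq_sum_sq_eigenvalues
      rw [trace_lapMatrix_mul_self,
        sum_sq_degree_of_degree_eq_card_edges (hc.trans hcard.symm), hcard, ← hμ] at h1
      have h2 := hsumT (· ^ 2)
      have hμ1' : μ i₁ = p + 1 := by linarith
      simp only [hμ1', ← h1] at h2
      rw [hμ1'] at hsum
      -- The squares sum to `p² + 3p - (p + 1)² = p - 1`, the eigenvalues to `2p - (p + 1) = p - 1`,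
      -- and there are `p - 1` of them.
      have h3 : ∑ i ∈ T.erase i₁, (μ i - 1) ^ 2 = 0 := by
        have : ∀ i, (μ i - 1) ^ 2 = μ i ^ 2 - 2 * μ i + 1 := fun i => by ring
        rw [sum_congr rfl fun i _ => this i, sum_add_distrib, sum_sub_distrib, ← mul_sum, hsum,
          sum_const, nsmul_eq_mul, hscast]
        linarith
      intro i hi
      have h4 := (sum_eq_zero_iff_of_nonneg fun i _ => sq_nonneg (μ i - 1)).1 h3 i hi
      have h5 := pow_eq_zero_iff (two_ne_zero) |>.1 h4
      simp only
      linarith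
  · have h1 := G.det_lapMatrix_add_ones
    rw [hdet, Fintype.card_fin, ← prod_mul_prod_compl T, ← mul_prod_erase T _ hi₁,
      prod_congr (s₁ := Tᶜ) rfl fun i hi => by rw [hout i (mem_compl.1 hi), sub_zero],
      prod_const, hTc, hexp, pow_add] at h1
    refine mul_left_cancel₀ (pow_ne_zero 2 hn0.ne') ?_
    rw [← h1]
    ring
  · have hunit : IsUnit (G.lapMatrix ℝ + of fun _ _ => 1 : Matrix (Fin n) (Fin n) ℝ).det := by
      rw [hdet]
      exact (prod_ne_zero_iff.2 fun i _ => (hpos i).ne').isUnit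
    rw [kirchhoffIndex_eq_trace_inv G hunit, hA,
      hH.trace_inv_smul_one_sub (fun i => by rw [← hμ]; exact (hpos i).ne'), ← hμ,
      hsumT fun t => ((n : ℝ) - t)⁻¹]
    have hl := (hpos i₁).ne'
    simp only [sub_zero]
    field_simp
    ring

end SimpleGraph

/-! ### The bound and its equality case -/

open Finset in
theorem theorem3p3 (n p : ℕ) (hp : 2 ≤ p) (hpn : p ≤ n / 2)
    (S : Finset (Sym2 (Fin n))) (hS : (S : Set (Sym2 (Fin n))) ⊆ (⊤ : SimpleGraph (Fin n)).edgeSet)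
    (hcard : S.card = p)
    (G : SimpleGraph (Fin n)) [DecidableRel G.Adj]
    (hG : G = (⊤ : SimpleGraph (Fin n)).deleteEdges (S : Set (Sym2 (Fin n)))) :
    G.Connected ∧
    kirchhoffIndex G ≤ (n : ℝ) - 1 - p + n / ((n : ℝ) - p - 1)
      + ((p : ℝ) - 1) * G.minDegree * (n : ℝ) ^ (n - p - 1) * ((n : ℝ) - 1) ^ (p - 2)
        / numSpanningTrees G ∧
    (kirchhoffIndex G = (n : ℝ) - 1 - p + n / ((n : ℝ) - p - 1)
      + ((p : ℝ) - 1) * G.minDegree * (n : ℝ) ^ (n - p - 1) * ((n : ℝ) - 1) ^ (p - 2)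
        / numSpanningTrees G ↔
      IsCompleteMinus G (completeBipartiteGraph (Fin 1) (Fin p))) := by
  have hedge : Gᶜ.edgeFinset = S := by
    ext e
    induction e with
    | _ u v =>
      have hne : s(u, v) ∈ S → u ≠ v := fun h => hS h
      rw [SimpleGraph.mem_edgeFinset, SimpleGraph.mem_edgeSet, SimpleGraph.compl_adj, hG,
        SimpleGraph.deleteEdges_adj, SimpleGraph.top_adj, mem_coe]
      tauto
  have hc : Gᶜ.edgeFinset.card = p := by rw [hedge, hcard]
  have : Nonempty (Fin n) := ⟨⟨0, by omega⟩⟩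
  refine ⟨SimpleGraph.connected_of_card_edges_compl_lt (by rw [hc, Fintype.card_fin]; omega), ?_⟩
  have hstar := G.isCompleteMinus_star_iff
  rw [hc] at hstar
  rw [hstar]
  obtain ⟨s, x, l, hs, hl, hx, hδ, hsum, hiff, heq, ht, hKf⟩ :=
    SimpleGraph.exists_spectral_data hp hpn G hc
  have hnp : (p : ℝ) + p ≤ n := by exact_mod_cast (by omega : p + p ≤ n)
  have hp2 : (2 : ℝ) ≤ p := by exact_mod_cast hp
  have hn0 : (0 : ℝ) < n := by linarith
  have hl₀ : 0 < (n : ℝ) - p - 1 := by linarith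
  have hlpos : 0 < l := hl₀.trans_le hl
  have hPpos : 0 < ∏ i ∈ s, x i := prod_pos hx
  have hscast : (s.card : ℝ) = p - 1 := by rw [hs, Nat.cast_sub (by omega), Nat.cast_one]
  have hlast : ((p : ℝ) - 1) * G.minDegree * (n : ℝ) ^ (n - p - 1) * ((n : ℝ) - 1) ^ (p - 2)
      / numSpanningTrees G =
      n * (G.minDegree / l * (s.card * ((n : ℝ) - 1) ^ (s.card - 1)) / ∏ i ∈ s, x i) := by
    -- As `n ≥ 2p ≥ p + 2`, none of these natural subtractions truncates.
    rw [ht, hscast, hs, show n - p - 1 = (n - p - 2) + 1 by omega, pow_succ,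
      show p - 1 - 1 = p - 2 by omega]
    have := pow_ne_zero (n - p - 2) hn0.ne'
    field_simp
  have hinv : ∑ i ∈ s, (x i)⁻¹ = (∑ i ∈ s, ∏ j ∈ s.erase i, x j) / ∏ i ∈ s, x i := by
    rw [sum_div]
    refine sum_congr rfl fun i hi => ?_
    rw [← mul_prod_erase s x hi]
    have h1 := (hx i hi).ne'
    have h2 : ∏ j ∈ s.erase i, x j ≠ 0 :=
      prod_ne_zero_iff.2 fun j hj => (hx j (mem_of_mem_erase hj)).ne'
    field_simp
  have hmac : ∑ i ∈ s, ∏ j ∈ s.erase i, x j ≤ s.card * ((n : ℝ) - 1) ^ (s.card - 1) := by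
    convert sum_prod_erase_le s (fun i hi => (hx i hi).le) hsum
  have hM0 : 0 ≤ (s.card : ℝ) * ((n : ℝ) - 1) ^ (s.card - 1) :=
    mul_nonneg (Nat.cast_nonneg _) (pow_nonneg (by linarith) _)
  have hδl : 1 ≤ G.minDegree / l := (one_le_div hlpos).2 hδ
  have h2 : (n : ℝ) * ∑ i ∈ s, (x i)⁻¹ ≤
      n * (G.minDegree / l * (s.card * ((n : ℝ) - 1) ^ (s.card - 1)) / ∏ i ∈ s, x i) := by
    rw [hinv]
    refine mul_le_mul_of_nonneg_left (div_le_div_of_nonneg_right ?_ hPpos.le) hn0.le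
    exact hmac.trans (le_mul_of_one_le_left hM0 hδl)
  have h1 : (n : ℝ) / l ≤ n / (n - p - 1) := div_le_div_of_nonneg_left hn0.le hl₀ hl
  rw [hlast, hKf]
  refine ⟨by linarith, ?_⟩
  rw [← hiff]
  constructor
  · intro h
    -- The bounds `h1` and `h2` add up to the claim, so equality makes each of them sharp; the first
    -- already determines `l`.
    have h3 : (n : ℝ) / l = n / (n - p - 1) := by linarith
    rw [div_eq_mul_inv, div_eq_mul_inv] at h3
    exact inv_injective (mul_left_cancel₀ hn0.ne' h3)
  · intro h
    obtain ⟨hδ', hx'⟩ := heq h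
    have h3 : ∑ i ∈ s, ∏ j ∈ s.erase i, x j = s.card * ((n : ℝ) - 1) ^ (s.card - 1) := by
      rw [← nsmul_eq_mul, ← sum_const]
      refine sum_congr rfl fun i hi => ?_
      rw [prod_congr rfl fun j hj => hx' j (mem_of_mem_erase hj), prod_const,
        card_erase_of_mem hi]
    rw [hinv, h3, hδ', div_self hlpos.ne', one_mul, h]
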